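/- Let $\mathbb{D}$ be the open unit disc in $\mathbb{R}^2$ and write $\widehat{f}$ for the Fourier transform. Let $\mathrm{PW}(\mathbb{D})$ be the closed subspace of $L^2(\mathbb{R}^2)$ consisting of the functions $f$ whose Fourier transform is supported in $\overline{\mathbb{D}}$. For a tempered distribution $\varphi$ on $\mathbb{R}^2$, the Hankel operator $\mathbf{H}_\varphi$ is defined, on the dense set of $f \in \mathrm{PW}(\mathbb{D})$ such that $\widehat{f}$ is smooth and compactly supported in $\mathbb{D}$, by \[\widehat{\mathbf{H}_\varphi f}(\eta) = \int_{\mathbb{D}} \widehat{f}(\xi)\,\widehat{\varphi}(\xi+\eta)\,d\xi, \qquad \eta \in \mathbb{D},\] with $\widehat{\mathbf{H}_\varphi f} = 0$ outside $\mathbb{D}$, the integral being understood as the pairing of the distribution $\widehat{\varphi}$ with the test function $\xi \mapsto \widehat{f}(\xi-\eta)$. The operator $\mathbf{H}_\varphi$ is called bounded if it extends to a bounded linear operator on $\mathrm{PW}(\mathbb{D})$, and it is said to have a bounded symbol if there is $\psi \in L^\infty(\mathbb{R}^2)$ such that the restrictions of $\widehat{\psi}$ and $\widehat{\varphi}$ to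 the open disc $2\mathbb{D}$ coincide as distributions. Theorem. There is a tempered distribution $\varphi$ on $\mathbb{R}^2$ such that the Hankel operator $\mathbf{H}_\varphi$ is bounded on $\mathrm{PW}(\mathbb{D})$ but does not have a bounded symbol. -/

import Mathlib

open MeasureTheory
open scoped SchwartzMap FourierTransform ENNReal

noncomputable section

/-- The Euclidean plane. -/
abbrev Plane : Type := EuclideanSpace ℝ (Fin 2)

/-- The open unit disc `𝔻`. -/
abbrev disc : Set Plane := Metric.ball 0 1

/-- The dilated disc `2𝔻`. -/
abbrev doubleDisc : Set Plane := Metric.ball 0 2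

/-- Square integrable complex functions on the plane. -/
abbrev L2Plane : Type := Lp ℂ 2 (volume : Measure Plane)

/-- The Paley–Wiener space of the unit disc: the `L²` functions on the plane whose
Fourier transform is supported in the closed unit disc. -/
def PaleyWiener : Submodule ℂ L2Plane where
  carrier := {f | ∀ᵐ ξ : Plane, ξ ∉ closure disc → (𝓕 f : L2Plane) ξ = 0}
  zero_mem' := by
    have h0 : (𝓕 (0 : L2Plane) : L2Plane) = 0 := (Lp.fourierTransformₗᵢ Plane ℂ).map_zero
    simp only [Set.mem_ofPred_eq]
    rw [h0]
    filter_upwards [Lp.coeFn_zero ℂ 2 (volume : Measure Plane)] with ξ h _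
    exact h
  add_mem' := by
    intro f g hf hg
    have h0 : (𝓕 (f + g) : L2Plane) = 𝓕 f + 𝓕 g :=
      (Lp.fourierTransformₗᵢ Plane ℂ).map_add f g
    simp only [Set.mem_ofPred_eq] at hf hg ⊢
    rw [h0]
    filter_upwards [hf, hg, Lp.coeFn_add (𝓕 f : L2Plane) (𝓕 g : L2Plane)] with ξ h1 h2 h hξ
    rw [h, Pi.add_apply, h1 hξ, h2 hξ, add_zero]
  smul_mem' := by
    intro c f hf
    have h0 : (𝓕 (c • f) : L2Plane) = c • 𝓕 f :=
      (Lp.fourierTransformₗᵢ Plane ℂ).map_smul c f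
    simp only [Set.mem_ofPred_eq] at hf ⊢
    rw [h0]
    filter_upwards [hf, Lp.coeFn_smul c (𝓕 f : L2Plane)] with ξ h1 h hξ
    rw [h, Pi.smul_apply, h1 hξ, smul_zero]

/-- For a tempered distribution `φ` and a test function `g` supported in the disc, the value at `η`
of `η ↦ ∫_𝔻 g(ξ) φ̂(ξ + η) dξ`, that is, the pairing of `φ̂` with the translate `g(· - η)`. -/
def hankelIntegral (φ : 𝓢'(Plane, ℂ)) (g : 𝓢(Plane, ℂ)) (η : Plane) : ℂ :=
  (𝓕 φ : 𝓢'(Plane, ℂ)) (g.compSubConstCLM ℂ η)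

/-- The bounded operator `T` on the Paley–Wiener space is (the continuous extension of) the Hankel
operator with symbol `φ`: whenever `f̂ = g` is smooth with compact support in the open disc, one has
`(T f)^(η) = ∫_𝔻 g(ξ) φ̂(ξ + η) dξ` on the disc. (A subset of the disc that is closed in
the plane is compact, so `tsupport g ⊆ disc` says that `g` is compactly supported in the disc.) -/
def IsHankelOperator (φ : 𝓢'(Plane, ℂ)) (T : PaleyWiener →L[ℂ] PaleyWiener) : Prop :=
  ∀ (f : PaleyWiener) (g : 𝓢(Plane, ℂ)), tsupport g ⊆ disc →
    (𝓕 (f : L2Plane) : L2Plane) = g.toLp 2 →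
      ∀ᵐ η : Plane, η ∈ disc →
        (𝓕 (T f : L2Plane) : L2Plane) η = hankelIntegral φ g η

/-- The Hankel operator with symbol `φ` has a bounded symbol: there is `ψ ∈ L^∞` such that the
restrictions of `ψ̂` and `φ̂` to `2𝔻` coincide as distributions. -/
def HasBoundedSymbol (φ : 𝓢'(Plane, ℂ)) : Prop :=
  ∃ ψ : Lp ℂ ∞ (volume : Measure Plane), ∀ u : 𝓢(Plane, ℂ), tsupport u ⊆ doubleDisc →
    (𝓕 (ψ : 𝓢'(Plane, ℂ)) : 𝓢'(Plane, ℂ)) u = (𝓕 φ : 𝓢'(Plane, ℂ)) u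

end

noncomputable section

/-! ### The nodes -/

/-! Write a_j, b_j for the inner and outer nodes and r_j for `lensRadius j`. The symbol has Fourier
transform ∑ (δ_{a_j} - δ_{b_j}). The nodes accumulate at (2, 0), so ∑ δ_{a_j} alone is not a
distribution on the plane. Since |a_j - b_j| ≤ 2 r_j is summable, the differences do converge, and
the points b_j, lying on the boundary circle, are invisible both to the Hankel operator and to test
functions supported in 2𝔻.

Boundedness: δ_{a_j} acts by g ↦ g(a_j - η), which for g supported in 𝔻 and η ∈ 𝔻 lives on the lens
𝔻 ∩ (a_j - 𝔻). The lenses are pairwise disjoint (`disjoint_lens`), so the whole sum acts as a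
measure preserving reflection followed by a cutoff, a contraction of L²
(`hankelIntegral_nodeSymbol`).

No bounded symbol: let w be a narrow even bump and W the sum of its translates to a_0, ..., a_{N-1}.
The symbol pairs with w * W to give N‖w‖² (`nodeDistribution_schwartzConv`). A bounded ψ would give
at most ‖ψ‖ ‖w‖ ‖W‖ = ‖ψ‖ √N ‖w‖² by Plancherel (`norm_pairing_fourier_schwartzConv_le`), which
fails for large N. -/

/-- Half the second coordinate of the `j`-th pair of nodes. -/
def nodeHeight (j : ℕ) : ℝ := (1 / 4) ^ (j + 1)

/-- The radius of a disc that contains the `j`-th lens. -/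
def lensRadius (j : ℕ) : ℝ := (1 / 4) ^ (j + 2)

/-- The `j`-th node inside `2𝔻`. -/
def innerNode (j : ℕ) : Plane :=
  !₂[2 * √(1 - nodeHeight j ^ 2 - lensRadius j ^ 2), 2 * nodeHeight j]

/-- The `j`-th node on the boundary of `2𝔻`. -/
def outerNode (j : ℕ) : Plane := !₂[2 * √(1 - nodeHeight j ^ 2), 2 * nodeHeight j]

lemma lensRadius_pos (j : ℕ) : 0 < lensRadius j := by unfold lensRadius; positivity

lemma nodeHeight_eq (j : ℕ) : nodeHeight j = 4 * lensRadius j := by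
  unfold nodeHeight lensRadius; ring

lemma lensRadius_antitone : Antitone lensRadius := fun j k h =>
  pow_le_pow_of_le_one (by norm_num) (by norm_num) (by omega)

lemma lensRadius_le (j : ℕ) : lensRadius j ≤ 1 / 16 := by
  have := lensRadius_antitone (Nat.zero_le j)
  norm_num [lensRadius] at this ⊢
  exact this

lemma lensRadius_summable : Summable lensRadius :=
  ((summable_nat_add_iff 2).2
    (summable_geometric_of_lt_one (by norm_num : (0 : ℝ) ≤ 1 / 4) (by norm_num)))

lemma norm_sq_innerNode (j : ℕ) : ‖innerNode j‖ ^ 2 = 4 * (1 - lensRadius j ^ 2) := by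
  have h0 := lensRadius_pos j
  have h1 := lensRadius_le j
  have h2 : 0 ≤ 1 - nodeHeight j ^ 2 - lensRadius j ^ 2 := by
    rw [nodeHeight_eq]; nlinarith
  simp only [innerNode, EuclideanSpace.norm_sq_eq, Fin.sum_univ_two, Real.norm_eq_abs, sq_abs]
  simp only [Matrix.cons_val_zero, Matrix.cons_val_one, mul_pow, Real.sq_sqrt h2]
  ring

lemma norm_outerNode (j : ℕ) : ‖outerNode j‖ = 2 := by
  have h0 := lensRadius_pos j
  have h1 := lensRadius_le j
  have h2 : 0 ≤ 1 - nodeHeight j ^ 2 := by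
    rw [nodeHeight_eq]; nlinarith
  have h : ‖outerNode j‖ ^ 2 = 2 ^ 2 := by
    simp only [outerNode, EuclideanSpace.norm_sq_eq, Fin.sum_univ_two, Real.norm_eq_abs, sq_abs]
    simp only [Matrix.cons_val_zero, Matrix.cons_val_one, mul_pow, Real.sq_sqrt h2]
    ring
  exact (pow_left_inj₀ (norm_nonneg _) (by norm_num) two_ne_zero).1 h

/-- Only the first coordinates differ, and (√B - √A)² ≤ B - A whenever 0 ≤ A ≤ B; here B - A = r_j².
-/
lemma norm_innerNode_sub_outerNode_le (j : ℕ) :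
    ‖innerNode j - outerNode j‖ ≤ 2 * lensRadius j := by
  have h0 := lensRadius_pos j
  have h1 := lensRadius_le j
  have h2 : 0 ≤ 1 - nodeHeight j ^ 2 - lensRadius j ^ 2 := by
    rw [nodeHeight_eq]; nlinarith
  have h3 : 0 ≤ 1 - nodeHeight j ^ 2 := by
    rw [nodeHeight_eq]; nlinarith
  have h : ‖innerNode j - outerNode j‖ ^ 2 ≤ (2 * lensRadius j) ^ 2 := by
    simp only [innerNode, outerNode, EuclideanSpace.norm_sq_eq, Fin.sum_univ_two,
      Real.norm_eq_abs, sq_abs, PiLp.sub_apply, Matrix.cons_val_zero, Matrix.cons_val_one]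
    have ha := Real.sq_sqrt h2
    have hb := Real.sq_sqrt h3
    have hab : √(1 - nodeHeight j ^ 2 - lensRadius j ^ 2) ≤ √(1 - nodeHeight j ^ 2) :=
      Real.sqrt_le_sqrt (by nlinarith)
    nlinarith [Real.sqrt_nonneg (1 - nodeHeight j ^ 2 - lensRadius j ^ 2)]
  exact (pow_le_pow_iff_left₀ (norm_nonneg _) (by positivity) two_ne_zero).1 h

/-- With heights 4 r_j and ratio 1/4, the gap is at least 3 r_j, while the radii add up to at most 5
r_j / 4. This separates both the lenses and the nodes. -/
lemma lensRadius_add_le_nodeHeight_sub {j k : ℕ} (h : j < k) :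
    lensRadius j + lensRadius k ≤ nodeHeight j - nodeHeight k := by
  have h1 : lensRadius k ≤ lensRadius (j + 1) := lensRadius_antitone h
  have h2 : lensRadius (j + 1) = lensRadius j / 4 := by unfold lensRadius; ring
  have h0 := lensRadius_pos j
  rw [nodeHeight_eq, nodeHeight_eq]
  linarith

lemma lensRadius_add_le_abs_nodeHeight_sub {j k : ℕ} (h : j ≠ k) :
    lensRadius j + lensRadius k ≤ |nodeHeight j - nodeHeight k| := by
  rcases h.lt_or_gt with h | h
  · exact (lensRadius_add_le_nodeHeight_sub h).trans (le_abs_self _)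
  · rw [abs_sub_comm, add_comm]
    exact (lensRadius_add_le_nodeHeight_sub h).trans (le_abs_self _)

lemma abs_coord_le_norm (x : Plane) (i : Fin 2) : |x i| ≤ ‖x‖ := by
  simpa using PiLp.norm_apply_le x i

lemma lensRadius_le_norm_innerNode_sub {j k : ℕ} (h : j ≠ k) :
    2 * lensRadius j ≤ ‖innerNode j - innerNode k‖ := by
  have h1 := abs_coord_le_norm (innerNode j - innerNode k) 1
  have h2 := lensRadius_add_le_abs_nodeHeight_sub h
  have h3 := lensRadius_pos k
  simp only [innerNode, PiLp.sub_apply, Matrix.cons_val_one, Matrix.cons_val_zero, ← mul_sub,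
    abs_mul, abs_two] at h1
  simp only [innerNode]
  linarith

/-- Expanding (‖a_j‖ - 2)² ≥ 0 gives 4‖a_j‖ ≤ 4 + ‖a_j‖² = 8 - 4 r_j². The margin r_j² is the room
for test functions around a_j inside 2𝔻. -/
lemma norm_innerNode_add_le (j : ℕ) : ‖innerNode j‖ + lensRadius j ^ 2 ≤ 2 := by
  nlinarith [norm_sq_innerNode j, norm_nonneg (innerNode j), sq_nonneg (‖innerNode j‖ - 2)]

/-! ### The lenses -/

/-- The points of the disc whose reflection in half the `j`-th inner node lies in the disc. -/
def lens (j : ℕ) : Set Plane := {η | ‖η‖ < 1 ∧ ‖innerNode j - η‖ < 1}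

lemma isOpen_lens (j : ℕ) : IsOpen (lens j) :=
  (isOpen_lt continuous_norm continuous_const).inter
    (isOpen_lt (continuous_const.sub continuous_id).norm continuous_const)

lemma reflect_mem_lens {j : ℕ} {η : Plane} : innerNode j - η ∈ lens j ↔ η ∈ lens j := by
  simp [lens, and_comm]

/-- By the parallelogram law ‖2η - a_j‖² < 4 - ‖a_j‖² = 4 r_j², so the lens lies in the disc of
radius r_j about a_j / 2; only the second coordinate is needed for disjointness. -/
lemma abs_coord_sub_lt_of_mem_lens {j : ℕ} {η : Plane} (h : η ∈ lens j) :
    |η 1 - nodeHeight j| < lensRadius j := by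
  obtain ⟨h1, h2⟩ := h
  have hp := parallelogram_law_with_norm ℝ η (innerNode j - η)
  have hn := norm_sq_innerNode j
  rw [add_sub_cancel] at hp
  have hc := abs_coord_le_norm (η - (innerNode j - η)) 1
  have e : (η - (innerNode j - η)) 1 = 2 * (η 1 - nodeHeight j) := by
    simp only [innerNode, PiLp.sub_apply, Matrix.cons_val_one, Matrix.cons_val_zero]
    ring
  rw [e, abs_mul, abs_two] at hc
  have hr := lensRadius_pos j
  refine lt_of_pow_lt_pow_left₀ 2 hr.le ?_
  nlinarith [norm_nonneg η, norm_nonneg (innerNode j - η), abs_nonneg (η 1 - nodeHeight j)]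

lemma disjoint_lens {j k : ℕ} (h : j ≠ k) : Disjoint (lens j) (lens k) := by
  rw [Set.disjoint_left]
  intro η hj hk
  have h1 := abs_coord_sub_lt_of_mem_lens hj
  have h2 := abs_coord_sub_lt_of_mem_lens hk
  have h3 := lensRadius_add_le_abs_nodeHeight_sub h
  have h4 := abs_sub_le (nodeHeight j) (η 1) (nodeHeight k)
  rw [abs_sub_comm (nodeHeight j) (η 1)] at h4
  linarith

/-- The reflection of each lens in its centre, extended by the identity. -/
def lensReflection (η : Plane) : Plane :=
  open Classical in if h : ∃ j, η ∈ lens j then innerNode h.choose - η else η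

lemma lensReflection_of_mem {j : ℕ} {η : Plane} (h : η ∈ lens j) :
    lensReflection η = innerNode j - η := by
  have hex : ∃ j, η ∈ lens j := ⟨j, h⟩
  have : hex.choose = j := by
    by_contra hne
    exact Set.disjoint_left.1 (disjoint_lens hne) hex.choose_spec h
  rw [lensReflection, dif_pos hex, this]

lemma lensReflection_of_notMem {η : Plane} (h : η ∉ ⋃ j, lens j) : lensReflection η = η := by
  rw [lensReflection, dif_neg (by simpa using h)]

lemma lensReflection_preimage (B : Set Plane) :
    lensReflection ⁻¹' B =
      (⋃ j, (fun η => innerNode j - η) ⁻¹' (B ∩ lens j)) ∪ (B \ ⋃ j, lens j) := by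
  ext η
  by_cases h : ∃ j, η ∈ lens j
  · obtain ⟨j, hj⟩ := h
    have hU : η ∈ ⋃ j, lens j := Set.mem_iUnion.2 ⟨j, hj⟩
    simp only [Set.mem_preimage, lensReflection_of_mem hj, Set.mem_union, Set.mem_iUnion,
      Set.mem_inter_iff, reflect_mem_lens, Set.mem_sdiff]
    constructor
    · exact fun hB => Or.inl ⟨j, hB, hj⟩
    · rintro (⟨k, hB, hk⟩ | ⟨-, hn⟩)
      · rwa [← lensReflection_of_mem hj, lensReflection_of_mem hk]
      · exact absurd ⟨j, hj⟩ hn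
  · have hU : η ∉ ⋃ j, lens j := by simpa using h
    simp only [Set.mem_preimage, lensReflection_of_notMem hU, Set.mem_union, Set.mem_iUnion,
      Set.mem_inter_iff, reflect_mem_lens, Set.mem_sdiff]
    constructor
    · exact fun hB => Or.inr ⟨hB, h⟩
    · rintro (⟨k, -, hk⟩ | ⟨hB, -⟩)
      · exact absurd ⟨k, hk⟩ h
      · exact hB

lemma measurableSet_iUnion_lens : MeasurableSet (⋃ j, lens j) :=
  MeasurableSet.iUnion fun j => (isOpen_lens j).measurableSet

lemma measurePreserving_lensReflection :
    MeasurePreserving lensReflection (volume : Measure Plane) volume := by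
  have hm (j : ℕ) : MeasurePreserving (fun η : Plane => innerNode j - η) volume volume :=
    volume.measurePreserving_sub_left (innerNode j)
  have hpre {B : Set Plane} (hB : MeasurableSet B) (j : ℕ) :
      MeasurableSet ((fun η => innerNode j - η) ⁻¹' (B ∩ lens j)) :=
    (hm j).measurable (hB.inter (isOpen_lens j).measurableSet)
  refine ⟨fun B hB => ?_, Measure.ext fun B hB => ?_⟩
  · rw [lensReflection_preimage]
    exact (MeasurableSet.iUnion (hpre hB)).union (hB.diff measurableSet_iUnion_lens)
  · have hmeas : Measurable lensReflection := fun B hB => by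
      rw [lensReflection_preimage]
      exact (MeasurableSet.iUnion (hpre hB)).union (hB.diff measurableSet_iUnion_lens)
    rw [Measure.map_apply hmeas hB, lensReflection_preimage, measure_union _
      (hB.diff measurableSet_iUnion_lens), measure_iUnion _ (hpre hB)]
    · have e (j : ℕ) : volume ((fun η => innerNode j - η) ⁻¹' (B ∩ lens j)) =
          volume (B ∩ lens j) :=
        (hm j).measure_preimage (hB.inter (isOpen_lens j).measurableSet).nullMeasurableSet
      simp_rw [e]
      rw [← measure_iUnion, ← Set.inter_iUnion, measure_inter_add_sdiff _ measurableSet_iUnion_lens]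
      · exact fun j k hjk => (disjoint_lens hjk).mono Set.inter_subset_right Set.inter_subset_right
      · exact fun j => hB.inter (isOpen_lens j).measurableSet
    · intro j k hjk
      refine (disjoint_lens hjk).mono ?_ ?_
      all_goals exact fun η hη => reflect_mem_lens.1 hη.2
    · rw [Set.disjoint_left]
      intro η hη hη'
      obtain ⟨j, hj⟩ := Set.mem_iUnion.1 hη
      exact hη'.2 (Set.mem_iUnion.2 ⟨j, reflect_mem_lens.1 hj.2⟩)

/-! ### The operator on the Fourier side -/

/-- Multiplication by the indicator function of a measurable set, as an operator on `L²`. -/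
def indicatorL2 {s : Set Plane} (hs : MeasurableSet s) : L2Plane →L[ℂ] L2Plane :=
  LinearMap.mkContinuous
    { toFun := fun f => ((Lp.memLp f).indicator hs).toLp _
      map_add' := fun f g => by
        rw [← MemLp.toLp_add]
        refine MemLp.toLp_congr _ _ ?_
        filter_upwards [Lp.coeFn_add f g] with x hx
        by_cases h : x ∈ s
        · simpa only [Pi.add_apply, Set.indicator_of_mem h] using hx
        · simp [h]
      map_smul' := fun c f => by
        rw [RingHom.id_apply, ← MemLp.toLp_const_smul]
        refine MemLp.toLp_congr _ _ ?_
        filter_upwards [Lp.coeFn_smul c f] with x hx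
        by_cases h : x ∈ s
        · simpa only [Pi.smul_apply, Set.indicator_of_mem h] using hx
        · simp [h] }
    1 fun f => by
      rw [one_mul]
      refine Lp.norm_le_norm_of_ae_le ?_
      filter_upwards [((Lp.memLp f).indicator hs).coeFn_toLp] with x hx
      simp only [LinearMap.coe_mk, AddHom.coe_mk]
      rw [hx]
      exact norm_indicator_le_norm_self _ _

lemma coeFn_indicatorL2 {s : Set Plane} (hs : MeasurableSet s) (f : L2Plane) :
    indicatorL2 hs f =ᵐ[volume] s.indicator f :=
  ((Lp.memLp f).indicator hs).coeFn_toLp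

/-- The Hankel operator on the Fourier side: reflect each lens and discard the other values. -/
def lensOperator : L2Plane →L[ℂ] L2Plane :=
  indicatorL2 measurableSet_iUnion_lens ∘L
    (Lp.compMeasurePreservingₗᵢ ℂ lensReflection
      measurePreserving_lensReflection).toContinuousLinearMap

lemma coeFn_lensOperator (f : L2Plane) :
    lensOperator f =ᵐ[volume] (⋃ j, lens j).indicator (f ∘ lensReflection) := by
  refine (coeFn_indicatorL2 measurableSet_iUnion_lens _).trans ?_
  filter_upwards [Lp.coeFn_compMeasurePreserving f measurePreserving_lensReflection] with x hx
  by_cases h : x ∈ ⋃ j, lens j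
  · rw [Set.indicator_of_mem h, Set.indicator_of_mem h]
    exact hx
  · rw [Set.indicator_of_notMem h, Set.indicator_of_notMem h]

/-- The Hankel operator on the Paley–Wiener space, obtained by conjugating `lensOperator` with the
Fourier transform. -/
def lensHankel : PaleyWiener →L[ℂ] PaleyWiener :=
  ((Lp.fourierTransformₗᵢ Plane ℂ).symm.toContinuousLinearEquiv.toContinuousLinearMap ∘L
    lensOperator ∘L (Lp.fourierTransformₗᵢ Plane ℂ).toContinuousLinearEquiv.toContinuousLinearMap ∘L
      PaleyWiener.subtypeL).codRestrict PaleyWiener fun f => by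
    have e : (𝓕 (𝓕⁻ (lensOperator (𝓕 (f : L2Plane))) : L2Plane) : L2Plane) =
        lensOperator (𝓕 (f : L2Plane)) := FourierTransform.fourier_fourierInv_eq _
    change ∀ᵐ ξ : Plane, ξ ∉ closure disc →
      (𝓕 (𝓕⁻ (lensOperator (𝓕 (f : L2Plane))) : L2Plane) : L2Plane) ξ = 0
    rw [e]
    filter_upwards [coeFn_lensOperator (𝓕 (f : L2Plane))] with ξ hξ hn
    rw [hξ, Set.indicator_of_notMem]
    intro h
    obtain ⟨j, hj⟩ := Set.mem_iUnion.1 h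
    exact hn (subset_closure (by simpa using hj.1))

lemma fourier_lensHankel (f : PaleyWiener) :
    (𝓕 (lensHankel f : L2Plane) : L2Plane) = lensOperator (𝓕 (f : L2Plane)) :=
  FourierTransform.fourier_fourierInv_eq (lensOperator (𝓕 (f : L2Plane)))

/-! ### The symbol -/

lemma norm_sub_le_seminorm_mul (u : 𝓢(Plane, ℂ)) (x y : Plane) :
    ‖u x - u y‖ ≤ SchwartzMap.seminorm ℂ 0 1 u * ‖x - y‖ := by
  refine Convex.norm_image_sub_le_of_norm_fderiv_le (𝕜 := ℝ) (s := Set.univ)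
    (fun z _ => u.differentiableAt) (fun z _ => ?_) convex_univ trivial trivial
  rw [← norm_iteratedFDeriv_one]
  exact SchwartzMap.norm_iteratedFDeriv_le_seminorm ℂ u 1 z

lemma norm_node_sub_le (u : 𝓢(Plane, ℂ)) (j : ℕ) :
    ‖u (innerNode j) - u (outerNode j)‖ ≤
      2 * SchwartzMap.seminorm ℂ 0 1 u * lensRadius j := by
  have h1 := norm_sub_le_seminorm_mul u (innerNode j) (outerNode j)
  have h2 := mul_le_mul_of_nonneg_left (norm_innerNode_sub_outerNode_le j)
    (apply_nonneg (SchwartzMap.seminorm ℂ 0 1) u)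
  linarith

lemma summable_node_sub (u : 𝓢(Plane, ℂ)) :
    Summable fun j => u (innerNode j) - u (outerNode j) :=
  Summable.of_norm_bounded (lensRadius_summable.mul_left _) (norm_node_sub_le u)

/-- The distribution `∑ j, (δ_{innerNode j} - δ_{outerNode j})`. -/
def nodeDistribution : 𝓢'(Plane, ℂ) :=
  ContinuousLinearMap.toPointwiseConvergenceCLM _ _ _ _ <|
    SchwartzMap.mkCLMtoNormedSpace (𝕜 := ℂ) (σ := RingHom.id ℂ)
      (fun u : 𝓢(Plane, ℂ) => ∑' j, (u (innerNode j) - u (outerNode j)))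
      (fun u v => by
        rw [← (summable_node_sub u).tsum_add (summable_node_sub v)]
        refine tsum_congr fun j => ?_
        simp only [add_apply]
        ring)
      (fun c u => by
        rw [RingHom.id_apply, smul_eq_mul, ← tsum_mul_left]
        refine tsum_congr fun j => ?_
        simp only [smul_apply, smul_eq_mul]
        ring)
      ⟨{(0, 1)}, 2 * ∑' j, lensRadius j,
        mul_nonneg zero_le_two (tsum_nonneg fun j => (lensRadius_pos j).le), fun u => by
        have h := tsum_of_norm_bounded (lensRadius_summable.mul_left _).hasSum (norm_node_sub_le u)
        rw [tsum_mul_left] at h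
        simp only [Finset.sup_singleton, schwartzSeminormFamily]
        linarith⟩

lemma nodeDistribution_apply (u : 𝓢(Plane, ℂ)) :
    nodeDistribution u = ∑' j, (u (innerNode j) - u (outerNode j)) := rfl

/-- The symbol, whose Fourier transform is `nodeDistribution`. -/
def nodeSymbol : 𝓢'(Plane, ℂ) := 𝓕⁻ nodeDistribution

lemma fourier_nodeSymbol : (𝓕 nodeSymbol : 𝓢'(Plane, ℂ)) = nodeDistribution :=
  FourierTransform.fourier_fourierInv_eq _

/-- For η in the open disc, ‖b_j - η‖ > 1 kills every outer term, and the inner term at a_j survives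
only if η lies in the `j`-th lens, hence for at most one `j`. -/
lemma hankelIntegral_nodeSymbol {g : 𝓢(Plane, ℂ)} (hg : tsupport g ⊆ disc) {η : Plane}
    (hη : η ∈ disc) :
    hankelIntegral nodeSymbol g η = (⋃ j, lens j).indicator (g ∘ lensReflection) η := by
  have hg0 {x : Plane} (hx : 1 ≤ ‖x‖) : g x = 0 := by
    refine image_eq_zero_of_notMem_tsupport fun h => ?_
    have := hg h
    rw [mem_ball_zero_iff] at this
    linarith
  rw [mem_ball_zero_iff] at hη
  have hout (j : ℕ) : g (outerNode j - η) = 0 := by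
    refine hg0 ?_
    have := norm_sub_norm_le (outerNode j) η
    rw [norm_outerNode] at this
    linarith
  have hin {j : ℕ} (hj : η ∉ lens j) : g (innerNode j - η) = 0 :=
    hg0 (not_lt.1 fun h => hj ⟨hη, h⟩)
  rw [hankelIntegral, fourier_nodeSymbol, nodeDistribution_apply]
  simp only [SchwartzMap.compSubConstCLM_apply, hout, sub_zero]
  by_cases h : ∃ j, η ∈ lens j
  · obtain ⟨j, hj⟩ := h
    rw [Set.indicator_of_mem (Set.mem_iUnion.2 ⟨j, hj⟩), Function.comp_apply,
      lensReflection_of_mem hj]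
    exact tsum_eq_single j fun k hk =>
      hin fun hk' => Set.disjoint_left.1 (disjoint_lens hk) hk' hj
  · rw [Set.indicator_of_notMem (by simpa using h)]
    push Not at h
    simp [hin (h _)]

lemma isHankelOperator_lensHankel : IsHankelOperator nodeSymbol lensHankel := by
  intro f g hg hfg
  rw [fourier_lensHankel, hfg]
  -- The Fourier transform equals `g` only almost everywhere; measure preservation carries this
  -- through composition with the reflection.
  have hae := measurePreserving_lensReflection.quasiMeasurePreserving.ae_eq_comp
    (g.coeFn_toLp 2 (volume : Measure Plane))
  filter_upwards [coeFn_lensOperator (g.toLp 2), hae] with η h1 h2 hη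
  rw [h1, hankelIntegral_nodeSymbol hg hη]
  by_cases h : η ∈ ⋃ j, lens j
  · rw [Set.indicator_of_mem h, Set.indicator_of_mem h, h2]
  · rw [Set.indicator_of_notMem h, Set.indicator_of_notMem h]

/-! ### Test functions -/

lemma SchwartzMap.integrable_norm_sq (f : 𝓢(Plane, ℂ)) : Integrable fun x => ‖f x‖ ^ 2 := by
  simpa using (f.memLp 2).integrable_norm_pow two_ne_zero

/-- A real even bump makes (w * w)(0) equal to ‖w‖², with no conjugation or reflection left over. -/
lemma exists_even_bump {ε : ℝ} (hε : 0 < ε) :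
    ∃ w : 𝓢(Plane, ℂ), (∀ x, ε ≤ ‖x‖ → w x = 0) ∧
      (∀ x, w x * w (-x) = ((‖w x‖ ^ 2 : ℝ) : ℂ)) ∧ 0 < ∫ x, ‖w x‖ ^ 2 := by
  let b : ContDiffBump (0 : Plane) := ⟨ε / 2, ε, by positivity, by linarith⟩
  have hc : HasCompactSupport fun x => (b x : ℂ) :=
    b.hasCompactSupport.comp_left (g := fun t : ℝ => (t : ℂ)) Complex.ofReal_zero
  have hd : ContDiff ℝ ((⊤ : ℕ∞) : WithTop ℕ∞) fun x => (b x : ℂ) :=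
    Complex.ofRealCLM.contDiff.comp b.contDiff
  let w : 𝓢(Plane, ℂ) := hc.toSchwartzMap hd
  have hw (x : Plane) : w x = (b x : ℂ) := rfl
  refine ⟨w, fun x hx => ?_, fun x => ?_, ?_⟩
  · rw [hw, b.zero_of_le_dist (by simpa using hx), Complex.ofReal_zero]
  · rw [hw, hw, b.neg, Complex.norm_real, Real.norm_eq_abs, sq_abs]
    push_cast
    ring
  · refine Continuous.integral_pos_of_hasCompactSupport_nonneg_nonzero (x := 0)
      (w.continuous.norm.pow 2) ?_ (fun x => by positivity) ?_
    · exact hc.comp_left (g := fun z : ℂ => ‖z‖ ^ 2) (by simp)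
    · rw [hw, b.one_of_mem_closedBall (by simpa [b] using (half_pos hε).le)]
      simp

/-- The convolution of two Schwartz functions. -/
abbrev schwartzConv (f g : 𝓢(Plane, ℂ)) : 𝓢(Plane, ℂ) :=
  SchwartzMap.convolution (ContinuousLinearMap.mul ℂ ℂ) f g

lemma schwartzConv_apply (f g : 𝓢(Plane, ℂ)) (x : Plane) :
    schwartzConv f g x = ∫ t, f t * g (x - t) := by
  rw [SchwartzMap.convolution_apply, MeasureTheory.convolution_def]
  rfl

lemma schwartzConv_translate (f g : 𝓢(Plane, ℂ)) (a x : Plane) :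
    schwartzConv f (g.compSubConstCLM ℂ a) x = schwartzConv f g (x - a) := by
  simp only [schwartzConv_apply, SchwartzMap.compSubConstCLM_apply]
  refine integral_congr_ae (Filter.Eventually.of_forall fun t => ?_)
  simp only [sub_right_comm x t a]

lemma schwartzConv_eq_zero {f g : 𝓢(Plane, ℂ)} {ε : ℝ} (hf : ∀ x, ε ≤ ‖x‖ → f x = 0)
    (hg : ∀ x, ε ≤ ‖x‖ → g x = 0) {x : Plane} (hx : 2 * ε ≤ ‖x‖) : schwartzConv f g x = 0 := by
  rw [schwartzConv_apply]
  refine integral_eq_zero_of_ae (Filter.Eventually.of_forall fun t => ?_)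
  rcases le_or_gt ε ‖t‖ with h | h
  · simp [hf t h]
  · have := norm_sub_norm_le x t
    simp [hg (x - t) (by linarith)]

/-- The sum of the translates of `w` to the first `N` inner nodes. -/
def nodeTranslates (w : 𝓢(Plane, ℂ)) (N : ℕ) : 𝓢(Plane, ℂ) :=
  ∑ k ∈ Finset.range N, w.compSubConstCLM ℂ (innerNode k)

lemma nodeTranslates_apply (w : 𝓢(Plane, ℂ)) (N : ℕ) (x : Plane) :
    nodeTranslates w N x = ∑ k ∈ Finset.range N, w (x - innerNode k) := by
  simp [nodeTranslates]

lemma schwartzConv_nodeTranslates (f w : 𝓢(Plane, ℂ)) (N : ℕ) (x : Plane) :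
    schwartzConv f (nodeTranslates w N) x =
      ∑ k ∈ Finset.range N, schwartzConv f w (x - innerNode k) := by
  simp only [schwartzConv, nodeTranslates, map_sum, sum_apply]
  exact Finset.sum_congr rfl fun k _ => schwartzConv_translate f w _ x

/-- The nodes are at least 2ε apart, so the translates have disjoint supports and their L² norms add
orthogonally. -/
lemma integral_norm_sq_nodeTranslates {w : 𝓢(Plane, ℂ)} {ε : ℝ} {N : ℕ}
    (hw : ∀ x, ε ≤ ‖x‖ → w x = 0) (hε : ∀ k < N, ε ≤ lensRadius k) :
    ∫ x, ‖nodeTranslates w N x‖ ^ 2 = N * ∫ x, ‖w x‖ ^ 2 := by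
  have hsep {x : Plane} {j k : ℕ} (hj : j < N) (hjk : j ≠ k) (h0 : w (x - innerNode j) ≠ 0) :
      w (x - innerNode k) = 0 := by
    refine hw _ (le_of_not_gt fun h => ?_)
    have h1 : ‖x - innerNode j‖ < ε := not_le.1 fun h => h0 (hw _ h)
    have h2 := lensRadius_le_norm_innerNode_sub hjk
    have h3 := norm_sub_le_norm_sub_add_norm_sub (innerNode j) x (innerNode k)
    rw [norm_sub_rev (innerNode j) x] at h3
    linarith [hε j hj]
  have hpt (x : Plane) : ‖nodeTranslates w N x‖ ^ 2 =
      ∑ k ∈ Finset.range N, ‖w (x - innerNode k)‖ ^ 2 := by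
    rw [nodeTranslates_apply]
    by_cases h : ∃ j ∈ Finset.range N, w (x - innerNode j) ≠ 0
    · obtain ⟨j, hj, h0⟩ := h
      have hz (k : ℕ) (_ : k ∈ Finset.range N) (hkj : k ≠ j) : w (x - innerNode k) = 0 :=
        hsep (Finset.mem_range.1 hj) hkj.symm h0
      rw [Finset.sum_eq_single_of_mem j hj hz,
        Finset.sum_eq_single_of_mem j hj fun k hk hkj => by simp [hz k hk hkj]]
    · push Not at h
      rw [Finset.sum_eq_zero h, Finset.sum_eq_zero fun k hk => by simp [h k hk]]
      simp
  simp_rw [hpt]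
  rw [integral_finsetSum _ fun k _ => w.integrable_norm_sq.comp_sub_right (innerNode k)]
  simp [integral_sub_right_eq_self (fun x => ‖w x‖ ^ 2)]

/-- The Fourier transform turns the convolution into a product; the weighted inequality 2ab ≤ c a² +
b² / c replaces Cauchy–Schwarz, and Plancherel returns to `f` and `g`. -/
lemma norm_pairing_fourier_schwartzConv_le (ψ : Lp ℂ ∞ (volume : Measure Plane))
    (f g : 𝓢(Plane, ℂ)) {c : ℝ} (hc : 0 < c) :
    ‖(𝓕 (ψ : 𝓢'(Plane, ℂ)) : 𝓢'(Plane, ℂ)) (schwartzConv f g)‖ ≤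
      ‖ψ‖ * ((c * ∫ x, ‖f x‖ ^ 2) + c⁻¹ * ∫ x, ‖g x‖ ^ 2) / 2 := by
  have hψ : ∀ᵐ x : Plane, ‖ψ x‖ ≤ ‖ψ‖ := by
    filter_upwards [enorm_ae_le_eLpNormEssSup ψ (volume : Measure Plane)] with x hx
    rw [Lp.norm_def, eLpNorm_exponent_top, ← toReal_enorm]
    refine ENNReal.toReal_mono ?_ hx
    simpa using Lp.eLpNorm_ne_top ψ
  have hF (x : Plane) : 𝓕 (schwartzConv f g) x = 𝓕 f x * 𝓕 g x := by
    rw [schwartzConv, SchwartzMap.fourier_convolution]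
    rfl
  rw [TemperedDistribution.fourier_apply, Lp.toTemperedDistribution_apply]
  have hint := (((𝓕 f).integrable_norm_sq.const_mul c).add
    ((𝓕 g).integrable_norm_sq.const_mul c⁻¹)).const_mul (‖ψ‖ / 2)
  refine (norm_integral_le_of_norm_le hint ?_).trans_eq ?_
  · filter_upwards [hψ] with x hx
    simp only [Pi.add_apply]
    rw [norm_smul, hF, norm_mul, mul_comm]
    have hab : ‖𝓕 f x‖ * ‖𝓕 g x‖ ≤ (c * ‖𝓕 f x‖ ^ 2 + c⁻¹ * ‖𝓕 g x‖ ^ 2) / 2 := by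
      have h : 0 ≤ c⁻¹ * (c * ‖𝓕 f x‖ - ‖𝓕 g x‖) ^ 2 := by positivity
      have e : c⁻¹ * (c * ‖𝓕 f x‖ - ‖𝓕 g x‖) ^ 2 =
          c * ‖𝓕 f x‖ ^ 2 + c⁻¹ * ‖𝓕 g x‖ ^ 2 - 2 * (‖𝓕 f x‖ * ‖𝓕 g x‖) := by
        field_simp
        ring
      linarith
    calc ‖ψ x‖ * (‖𝓕 f x‖ * ‖𝓕 g x‖)
        ≤ ‖ψ‖ * ((c * ‖𝓕 f x‖ ^ 2 + c⁻¹ * ‖𝓕 g x‖ ^ 2) / 2) :=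
          mul_le_mul hx hab (by positivity) (norm_nonneg _)
      _ = ‖ψ‖ / 2 * (c * ‖𝓕 f x‖ ^ 2 + c⁻¹ * ‖𝓕 g x‖ ^ 2) := by ring
  · simp only [Pi.add_apply]
    rw [integral_const_mul, integral_add ((𝓕 f).integrable_norm_sq.const_mul c)
      ((𝓕 g).integrable_norm_sq.const_mul c⁻¹), integral_const_mul, integral_const_mul,
      SchwartzMap.integral_norm_sq_fourier, SchwartzMap.integral_norm_sq_fourier]
    ring

/-! ### The symbol is not bounded -/

lemma tsupport_schwartzConv_nodeTranslates_subset {w : 𝓢(Plane, ℂ)} {ε : ℝ} {N : ℕ} (h0 : 0 < ε)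
    (hw : ∀ x, ε ≤ ‖x‖ → w x = 0) (hε : ∀ k < N, 4 * ε ≤ lensRadius k ^ 2) :
    tsupport (schwartzConv w (nodeTranslates w N)) ⊆ doubleDisc := by
  refine (closure_minimal (t := Metric.closedBall 0 (2 - 2 * ε)) ?_
    Metric.isClosed_closedBall).trans (Metric.closedBall_subset_ball (by linarith))
  intro x hx
  rw [Function.mem_support, schwartzConv_nodeTranslates] at hx
  obtain ⟨k, hk, hne⟩ := Finset.exists_ne_zero_of_sum_ne_zero hx
  have h1 : ‖x - innerNode k‖ < 2 * ε :=
    not_le.1 fun h => hne (schwartzConv_eq_zero hw hw h)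
  have h2 := norm_innerNode_add_le k
  have h3 := norm_sub_norm_le x (innerNode k)
  have h4 := hε k (Finset.mem_range.1 hk)
  rw [mem_closedBall_zero_iff]
  linarith

/-- The support condition removes the outer nodes. At a_j the convolution is the sum over k < N of
(w * w)(a_j - a_k), where separation leaves only k = j. -/
lemma nodeDistribution_schwartzConv {w : 𝓢(Plane, ℂ)} {ε : ℝ} {N : ℕ} (h0 : 0 < ε)
    (hw : ∀ x, ε ≤ ‖x‖ → w x = 0) (hε : ∀ k < N, 4 * ε ≤ lensRadius k ^ 2)
    (heven : ∀ x, w x * w (-x) = ((‖w x‖ ^ 2 : ℝ) : ℂ)) :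
    nodeDistribution (schwartzConv w (nodeTranslates w N)) =
      ((N * ∫ x, ‖w x‖ ^ 2 : ℝ) : ℂ) := by
  have hout (j : ℕ) : schwartzConv w (nodeTranslates w N) (outerNode j) = 0 := by
    refine image_eq_zero_of_notMem_tsupport fun h => ?_
    have := tsupport_schwartzConv_nodeTranslates_subset h0 hw hε h
    rw [mem_ball_zero_iff, norm_outerNode] at this
    exact lt_irrefl _ this
  have hcenter : schwartzConv w w 0 = ((∫ x, ‖w x‖ ^ 2 : ℝ) : ℂ) := by
    rw [schwartzConv_apply, ← integral_complex_ofReal]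
    simp_rw [zero_sub, heven]
  have hoff {j k : ℕ} (hk : k < N) (hjk : k ≠ j) :
      schwartzConv w w (innerNode j - innerNode k) = 0 := by
    refine schwartzConv_eq_zero hw hw ?_
    rw [norm_sub_rev]
    have h1 := lensRadius_le_norm_innerNode_sub hjk
    nlinarith [hε k hk, lensRadius_le k, lensRadius_pos k]
  rw [nodeDistribution_apply]
  simp only [hout, sub_zero]
  rw [tsum_eq_sum (s := Finset.range N)]
  · have (j : ℕ) (hj : j ∈ Finset.range N) :
        schwartzConv w (nodeTranslates w N) (innerNode j) = ((∫ x, ‖w x‖ ^ 2 : ℝ) : ℂ) := by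
      rw [schwartzConv_nodeTranslates, Finset.sum_eq_single_of_mem j hj, sub_self, hcenter]
      exact fun k hk hkj => hoff (Finset.mem_range.1 hk) hkj
    rw [Finset.sum_congr rfl this]
    simp
  · intro j hj
    rw [schwartzConv_nodeTranslates]
    refine Finset.sum_eq_zero fun k hk => hoff (Finset.mem_range.1 hk) ?_
    rintro rfl
    exact hj hk

lemma not_hasBoundedSymbol_nodeSymbol : ¬ HasBoundedSymbol nodeSymbol := by
  rintro ⟨ψ, hψ⟩
  obtain ⟨M, hM⟩ := exists_nat_gt ‖ψ‖
  have hM0 : (0 : ℝ) < M := (norm_nonneg ψ).trans_lt hM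
  have hr := lensRadius_pos (M ^ 2)
  -- With N = M² translates, the bump radius is a quarter of the smallest margin r_N², which serves
  -- all k < N because the radii decrease.
  have h0 : 0 < lensRadius (M ^ 2) ^ 2 / 4 := by positivity
  have hε (k : ℕ) (hk : k < M ^ 2) : 4 * (lensRadius (M ^ 2) ^ 2 / 4) ≤ lensRadius k ^ 2 := by
    have := pow_le_pow_left₀ hr.le (lensRadius_antitone hk.le) 2
    linarith
  obtain ⟨w, hw, heven, hpos⟩ := exists_even_bump h0
  have h1 := hψ _ (tsupport_schwartzConv_nodeTranslates_subset h0 hw hε)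
  rw [fourier_nodeSymbol, nodeDistribution_schwartzConv h0 hw hε heven] at h1
  -- The weight c = M = √N balances the two terms, so the bound becomes M² I ≤ ‖ψ‖ M I, against ‖ψ‖
  -- < M.
  have h2 := norm_pairing_fourier_schwartzConv_le ψ w (nodeTranslates w (M ^ 2)) hM0
  rw [h1, Complex.norm_real, Real.norm_of_nonneg (by positivity),
    integral_norm_sq_nodeTranslates hw fun k hk => by
      nlinarith [hε k hk, lensRadius_le k, lensRadius_pos k]] at h2
  set I := ∫ x, ‖w x‖ ^ 2
  have e : ‖ψ‖ * (M * I + (M : ℝ)⁻¹ * (((M ^ 2 : ℕ) : ℝ) * I)) / 2 = ‖ψ‖ * (M * I) := by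
    push_cast
    field_simp
    ring
  rw [e] at h2
  push_cast at h2
  have h3 := mul_lt_mul_of_pos_right hM (mul_pos hM0 hpos)
  nlinarith

end

theorem theorem1 :
    ∃ φ : 𝓢'(Plane, ℂ),
      (∃ T : PaleyWiener →L[ℂ] PaleyWiener, IsHankelOperator φ T) ∧ ¬ HasBoundedSymbol φ :=
  ⟨nodeSymbol, ⟨lensHankel, isHankelOperator_lensHankel⟩, not_hasBoundedSymbol_nodeSymbol⟩
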